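/- A $C^\infty$-function $f:(0,\infty)\to\mathbb R$ is completely monotonic if $(-1)^n f^{(n)}(x)\ge 0$ for all $n\ge 0$ and $x>0$. A $C^\infty$-function $f:(0,\infty)\to(0,\infty)$ is logarithmically completely monotonic if $-f'/f=-(\log f)'$ is completely monotonic, and it is a Horn-Bernstein function if its derivative $f'$ is (positive and) logarithmically completely monotonic. For $a>0$ let $$h_a(x)=\left(1+\frac1x\right)^{ax},\qquad x>0.$$ Then there is a constant $b^*>0$ such that, for every $a>0$, $h_a$ is a Horn-Bernstein function if and only if $a\le b^*$. Moreover $b^*\approx 2.189$, in the sense that $|b^*-2.189|<0.0005$. -/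

import Mathlib

open scoped ContDiff

/-- `f` is completely monotonic on `(0, ∞)`: it is `C^∞` there and
`(-1)^n f^{(n)}(x) ≥ 0` for all `n ≥ 0` and `x > 0`.  Functions on `(0, ∞)` are represented by
functions on `ℝ` of which only the values on the open set `(0, ∞)` matter. -/
def IsCompletelyMonotonic (f : ℝ → ℝ) : Prop :=
  ContDiffOn ℝ ∞ f (Set.Ioi 0) ∧
    ∀ n : ℕ, ∀ x : ℝ, 0 < x → 0 ≤ (-1 : ℝ) ^ n * iteratedDeriv n f x

/-- `f` is logarithmically completely monotonic on `(0, ∞)`: it is a positive `C^∞` function there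
and `-f'/f = -(log f)'` is completely monotonic. -/
def IsLogCompletelyMonotonic (f : ℝ → ℝ) : Prop :=
  ContDiffOn ℝ ∞ f (Set.Ioi 0) ∧ (∀ x : ℝ, 0 < x → 0 < f x) ∧
    IsCompletelyMonotonic (fun x => -(deriv f x / f x))

/-- `f` is a Horn-Bernstein function: it is a positive `C^∞` function on `(0, ∞)` whose derivative
is logarithmically completely monotonic. -/
def IsHornBernstein (f : ℝ → ℝ) : Prop :=
  ContDiffOn ℝ ∞ f (Set.Ioi 0) ∧ (∀ x : ℝ, 0 < x → 0 < f x) ∧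
    IsLogCompletelyMonotonic (deriv f)

/-- The function `h_a(x) = (1 + 1/x)^{a x}`, considered for `x > 0`. -/
noncomputable def hornFun (a : ℝ) (x : ℝ) : ℝ :=
  (1 + 1 / x) ^ (a * x)

/-!
Write `h_a = exp (a g)` with `g x = x log (1 + 1/x)`. Then `-(log h_a')' = -g''/g' - a g'`, and the
task is to decide for which `a` this function is completely monotonic. In the variable
`v = 1 / (1 + x)`, which ranges over `(0, 1)`, one has
`g' = -log (1 - v) - v = ∑_{n ≥ 1} v^{n+1} / (n+1)` (`tsum_logCoeff`) and
`-g''/g' = v^3 / ((1 - v) (-log (1 - v) - v)) = ∑ νₙ v^{n+1}` (`tsum_renewalSeq`), where `νₙ` solves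
a renewal equation with positive weights of total mass `1`; in particular `0 ≤ νₙ ≤ 2`.

Since `1 / (1 + x)^{n+1}` is the Laplace transform of `e^{-s} sⁿ / n!`, the function
`-(log h_a')'` is the Laplace transform of `e^{-s} (N s - a G s)`, with `N` and `G` the exponential
generating functions of the two coefficient sequences
(`neg_logDeriv_deriv_hornFun_eq_laplace`). The Laplace transform of a bounded continuous density is
completely monotonic exactly when the density is nonnegative: one direction is
`iteratedDeriv_laplace`, and the other, `nonneg_of_forall_integral_nonneg`, lets the weights
`sⁿ e^{-ns/t}` concentrate at `t`. Hence `h_a` is a Horn-Bernstein function if and only if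
`a ≤ N s / G s` for all `s > 0`, and the critical value is the infimum of `N / G`.

It remains to locate this infimum. The coefficients of `N - a G` are nonnegative from index `4` on
for `a ≤ 2.19` (`renewalSeq_ge`), so a Taylor polynomial, positive by an explicit certificate, shows
that `N ≥ 2.18852 G` (`mul_expGenFun_logCoeff_le`); at `s = 10 / 3` a Taylor polynomial with a remainder
estimate gives `N < 2.189 G` (`expGenFun_renewalSeq_lt`).
-/

open MeasureTheory Set Filter
open scoped Topology Nat

/-! ### Exponential generating functions of bounded sequences -/

/-- The exponential generating function `∑ dₙ sⁿ / n!` of a real sequence `d`. -/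
noncomputable def expGenFun (d : ℕ → ℝ) (s : ℝ) : ℝ :=
  ∑' n : ℕ, d n * (s ^ n / n !)

theorem summable_expGenFun {d : ℕ → ℝ} {C : ℝ} (hd : ∀ n, |d n| ≤ C) (s : ℝ) :
    Summable fun n : ℕ => d n * (s ^ n / n !) := by
  refine Summable.of_norm_bounded ((Real.summable_pow_div_factorial |s|).mul_left C) fun n => ?_
  rw [norm_mul, norm_div, norm_pow, Real.norm_eq_abs, Real.norm_eq_abs, Real.norm_natCast]
  gcongr
  exact hd n

theorem abs_expGenFun_le {d : ℕ → ℝ} {C : ℝ} (hd : ∀ n, |d n| ≤ C) {s : ℝ} (hs : 0 ≤ s) :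
    |expGenFun d s| ≤ C * Real.exp s := by
  have h1 : HasSum (fun n : ℕ => C * (s ^ n / n !)) (C * Real.exp s) := by
    rw [Real.exp_eq_exp_ℝ]
    exact (NormedSpace.expSeries_div_hasSum_exp s).mul_left C
  rw [← Real.norm_eq_abs]
  refine tsum_of_norm_bounded h1 fun n => ?_
  rw [norm_mul, Real.norm_eq_abs, Real.norm_of_nonneg (by positivity)]
  gcongr
  exact hd n

theorem continuous_expGenFun {d : ℕ → ℝ} {C : ℝ} (hd : ∀ n, |d n| ≤ C) :
    Continuous (expGenFun d) := by
  rw [continuous_iff_continuousAt]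
  intro s
  have hC : ContinuousOn (expGenFun d) (Metric.ball 0 (|s| + 1)) := by
    refine continuousOn_tsum (u := fun n : ℕ => C * ((|s| + 1) ^ n / n !))
      (fun n => by fun_prop) ((Real.summable_pow_div_factorial _).mul_left C) ?_
    intro n x hx
    rw [norm_mul, norm_div, norm_pow, Real.norm_eq_abs, Real.norm_natCast]
    have hx' : ‖x‖ ≤ |s| + 1 := by simpa using (mem_ball_zero_iff.1 hx).le
    have := hd n
    have := (abs_nonneg _).trans this
    gcongr
  exact hC.continuousAt (Metric.isOpen_ball.mem_nhds (by simp))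

theorem expGenFun_sub_const_mul {d e : ℕ → ℝ} {C D : ℝ} (hd : ∀ n, |d n| ≤ C)
    (he : ∀ n, |e n| ≤ D) (a s : ℝ) :
    expGenFun (fun n => d n - a * e n) s = expGenFun d s - a * expGenFun e s := by
  unfold expGenFun
  rw [← tsum_mul_left, ← (summable_expGenFun hd s).tsum_sub ((summable_expGenFun he s).mul_left a)]
  exact tsum_congr fun n => by ring

theorem integrableOn_pow_mul_exp_neg (n : ℕ) {c : ℝ} (hc : 0 < c) :
    IntegrableOn (fun s : ℝ => s ^ n * Real.exp (-(c * s))) (Ioi 0) := by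
  have h := integrableOn_rpow_mul_exp_neg_mul_rpow (p := 1) (s := n) (b := c)
    (by have := n.cast_nonneg (α := ℝ); linarith) one_pos hc
  refine h.congr_fun (fun s _ => ?_) measurableSet_Ioi
  simp

theorem integral_pow_mul_exp_neg (n : ℕ) {c : ℝ} (hc : 0 < c) :
    ∫ s in Ioi (0 : ℝ), s ^ n * Real.exp (-(c * s)) = n ! / c ^ (n + 1) := by
  have h := Real.integral_rpow_mul_exp_neg_mul_Ioi (a := n + 1) (r := c) (by positivity) hc
  rw [Real.Gamma_nat_eq_factorial] at h
  have e : (n ! : ℝ) / c ^ (n + 1) = (1 / c) ^ ((n : ℝ) + 1) * (n ! : ℝ) := by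
    rw [← Nat.cast_succ, Real.rpow_natCast, Nat.succ_eq_add_one, one_div_pow]
    ring
  rw [e, ← h]
  refine setIntegral_congr_fun measurableSet_Ioi fun s _ => ?_
  simp

/-- The Laplace transform of `e^{-s} ∑ dₙ sⁿ / n!` is the power series `∑ dₙ / (1 + x)^{n + 1}`. -/
theorem integral_exp_neg_mul_expGenFun {d : ℕ → ℝ} {C : ℝ} (hd : ∀ n, |d n| ≤ C) {x : ℝ}
    (hx : 0 < x) :
    ∫ s in Ioi (0 : ℝ), Real.exp (-(x * s)) * (Real.exp (-s) * expGenFun d s)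
      = ∑' n : ℕ, d n * (1 / (1 + x)) ^ (n + 1) := by
  set F : ℕ → ℝ → ℝ := fun n s => d n / n ! * (s ^ n * Real.exp (-((1 + x) * s))) with hF
  have hx1 : 0 < 1 + x := by linarith
  have hint : ∀ n, IntegrableOn (F n) (Ioi 0) := fun n =>
    (integrableOn_pow_mul_exp_neg n hx1).const_mul _
  have hval : ∀ n (e : ℝ), ∫ s in Ioi (0 : ℝ), e / n ! * (s ^ n * Real.exp (-((1 + x) * s)))
      = e * (1 / (1 + x)) ^ (n + 1) := fun n e => by
    rw [integral_const_mul, integral_pow_mul_exp_neg n hx1]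
    have := Nat.factorial_pos n
    rw [one_div, inv_pow]
    field_simp
  have hnorm : ∀ n, ∫ s in Ioi (0 : ℝ), ‖F n s‖ = |d n| * (1 / (1 + x)) ^ (n + 1) := fun n => by
    rw [← hval]
    refine setIntegral_congr_fun measurableSet_Ioi fun s (hs : 0 < s) => ?_
    simp only [hF]
    rw [norm_mul, norm_div, Real.norm_eq_abs, Real.norm_natCast,
      Real.norm_of_nonneg (by positivity)]
  have hv : 1 / (1 + x) < 1 := by rw [div_lt_one hx1]; linarith
  have hsum : Summable fun n => ∫ s in Ioi (0 : ℝ), ‖F n s‖ := by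
    simp only [hnorm]
    have hg : Summable fun n : ℕ => C * (1 / (1 + x)) ^ (n + 1) :=
      ((summable_nat_add_iff 1).2 (summable_geometric_of_lt_one (by positivity) hv)).mul_left C
    refine hg.of_nonneg_of_le (fun n => by positivity) fun n => ?_
    gcongr
    exact hd n
  rw [← tsum_congr fun n => hval n (d n)]
  change _ = ∑' n, ∫ s in Ioi (0 : ℝ), F n s
  rw [integral_tsum_of_summable_integral_norm hint hsum]
  refine setIntegral_congr_fun measurableSet_Ioi fun s _ => ?_
  simp only [hF, expGenFun]
  rw [← tsum_mul_left, ← tsum_mul_left]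
  refine tsum_congr fun n => ?_
  rw [show -((1 + x) * s) = -(x * s) + -s by ring, Real.exp_add]
  ring

/-! ### Laplace transforms of bounded continuous densities -/

section Laplace

variable {k : ℝ → ℝ} {C : ℝ}

theorem integrableOn_pow_mul_exp_neg_mul (hk : Continuous k) (hC : ∀ s, 0 < s → |k s| ≤ C)
    (n : ℕ) {x : ℝ} (hx : 0 < x) :
    IntegrableOn (fun s => s ^ n * Real.exp (-(x * s)) * k s) (Ioi 0) := by
  refine Integrable.mul_bdd (c := C) (integrableOn_pow_mul_exp_neg n hx)
    hk.aestronglyMeasurable ?_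
  exact (ae_restrict_iff' measurableSet_Ioi).2 (Eventually.of_forall fun s hs => hC s hs)

theorem hasDerivAt_laplace (hk : Continuous k) (hC : ∀ s, 0 < s → |k s| ≤ C) (n : ℕ) {x : ℝ}
    (hx : 0 < x) :
    HasDerivAt (fun y => ∫ s in Ioi (0 : ℝ), s ^ n * Real.exp (-(y * s)) * k s)
      (-∫ s in Ioi (0 : ℝ), s ^ (n + 1) * Real.exp (-(x * s)) * k s) x := by
  have hC0 : 0 ≤ C := (abs_nonneg _).trans (hC 1 one_pos)
  rw [← integral_neg]
  refine (hasDerivAt_integral_of_dominated_loc_of_deriv_le (𝕜 := ℝ) (s := Ioi (x / 2))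
    (bound := fun s => C * (s ^ (n + 1) * Real.exp (-(x / 2 * s))))
    (F := fun y s => s ^ n * Real.exp (-(y * s)) * k s)
    (F' := fun y s => -(s ^ (n + 1) * Real.exp (-(y * s)) * k s))
    (Ioi_mem_nhds (by linarith)) ?_ (integrableOn_pow_mul_exp_neg_mul hk hC n hx) ?_ ?_ ?_ ?_).2
  · exact Eventually.of_forall fun y => (by fun_prop : Continuous _).aestronglyMeasurable
  · exact (by fun_prop : Continuous _).aestronglyMeasurable
  · refine (ae_restrict_iff' measurableSet_Ioi).2 (Eventually.of_forall ?_)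
    intro s (hs : 0 < s) y (hy : x / 2 < y)
    rw [norm_neg, norm_mul, Real.norm_of_nonneg (by positivity), mul_comm]
    gcongr
    exact hC s hs
  · exact (integrableOn_pow_mul_exp_neg (n + 1) (by positivity)).const_mul C
  · refine Eventually.of_forall fun s y _ => ?_
    have h1 : HasDerivAt (fun y : ℝ => -(y * s)) (-s) y := ((hasDerivAt_mul_const s).neg :)
    refine ((h1.exp.const_mul (s ^ n)).mul_const (k s)).congr_deriv ?_
    ring

/-- Differentiation under the integral sign, up to the sign `(-1)ⁿ`: if the density `k` is
nonnegative, then its Laplace transform is completely monotonic. -/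
theorem iteratedDeriv_laplace (hk : Continuous k) (hC : ∀ s, 0 < s → |k s| ≤ C) (n : ℕ) {x : ℝ}
    (hx : 0 < x) :
    (-1 : ℝ) ^ n * iteratedDeriv n (fun y => ∫ s in Ioi (0 : ℝ), Real.exp (-(y * s)) * k s) x
      = ∫ s in Ioi (0 : ℝ), s ^ n * Real.exp (-(x * s)) * k s := by
  induction n generalizing x with
  | zero => simp
  | succ n ih =>
    have hev : iteratedDeriv n (fun y => ∫ s in Ioi (0 : ℝ), Real.exp (-(y * s)) * k s)
        =ᶠ[𝓝 x] fun y => (-1 : ℝ) ^ n * ∫ s in Ioi (0 : ℝ), s ^ n * Real.exp (-(y * s)) * k s := by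
      filter_upwards [Ioi_mem_nhds hx] with y hy
      rw [← ih hy, ← mul_assoc, ← mul_pow]
      simp
    rw [iteratedDeriv_succ, hev.deriv_eq, ((hasDerivAt_laplace hk hC n hx).const_mul _).deriv,
      ← mul_assoc, ← pow_add, show n + 1 + n = 2 * n + 1 by ring, pow_succ, pow_mul]
    simp

/-- The weight `s e^{-s/t}` has a strict global maximum at `s = t`; its large powers therefore
concentrate the integral of `k` near `t`. -/
theorem nonneg_of_forall_integral_nonneg (hk : Continuous k) (hC : ∀ s, 0 < s → |k s| ≤ C)
    (h : ∀ (n : ℕ) (x : ℝ), 0 < x → 0 ≤ ∫ s in Ioi (0 : ℝ), s ^ n * Real.exp (-(x * s)) * k s)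
    {t : ℝ} (ht : 0 < t) : 0 ≤ k t := by
  by_contra! hneg
  set p : ℝ → ℝ := fun s => s * Real.exp (-(s / t)) with hp
  have hpc : Continuous p := by fun_prop
  have hp0 : ∀ s, 0 < s → 0 < p s := fun s hs => by positivity
  have hC0 : 0 ≤ C := (abs_nonneg _).trans (hC t ht)
  -- `p` increases before `t` and decreases after it
  have hmono : ∀ s t', 0 < t' → (s - t') / t' ≤ (s - t') / t → p s ≤ p t' := by
    intro s t' ht' hst
    have h1 : s / t' ≤ Real.exp ((s - t') / t) := by
      have h2 := Real.add_one_le_exp ((s - t') / t')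
      have h3 : (s - t') / t' + 1 = s / t' := by field_simp; ring
      exact (h3 ▸ h2).trans (Real.exp_le_exp.2 hst)
    rw [div_le_iff₀ ht'] at h1
    calc p s ≤ Real.exp ((s - t') / t) * t' * Real.exp (-(s / t)) := by
          simp only [hp]; gcongr
      _ = t' * (Real.exp ((s - t') / t) * Real.exp (-(s / t))) := by ring
      _ = p t' := by
          rw [← Real.exp_add]
          simp only [hp]
          congr 2
          ring
  have hlt : ∀ s, s ≠ t → p s < p t := by
    intro s hs
    have h2 := Real.add_one_lt_exp (x := s / t - 1) (by
      rw [sub_ne_zero]; intro h; exact hs ((div_eq_one_iff_eq ht.ne').1 h))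
    rw [sub_add_cancel, div_lt_iff₀ ht] at h2
    calc p s < Real.exp (s / t - 1) * t * Real.exp (-(s / t)) := by
          simp only [hp]; gcongr
      _ = t * (Real.exp (s / t - 1) * Real.exp (-(s / t))) := by ring
      _ = p t := by
          rw [← Real.exp_add]
          simp only [hp]
          congr 2
          rw [div_self ht.ne']
          ring
  obtain ⟨δ, hδ, hδt, hkδ⟩ : ∃ δ, 0 < δ ∧ δ < t ∧ ∀ s, |s - t| < δ → k s < k t / 2 := by
    have h1 : ∀ᶠ s in 𝓝 t, k s < k t / 2 :=
      hk.continuousAt.eventually_lt continuousAt_const (by linarith)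
    obtain ⟨δ, hδ, h2⟩ := Metric.eventually_nhds_iff.1 h1
    refine ⟨min δ (t / 2), by positivity, (min_le_right _ _).trans_lt (by linarith), ?_⟩
    exact fun s hs => h2 (hs.trans_le (min_le_left _ _))
  set q := max (p (t - δ)) (p (t + δ)) with hq
  have hq0 : 0 < q := lt_max_of_lt_right (hp0 _ (by linarith))
  have hqt : q < p t := max_lt (hlt _ (by linarith)) (hlt _ (by linarith))
  have hfar : ∀ s, 0 < s → δ ≤ |s - t| → p s ≤ q := by
    intro s hs hst
    rcases le_abs.1 hst with h1 | h1
    · refine le_max_of_le_right (hmono s (t + δ) (by linarith) ?_)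
      gcongr <;> linarith
    · refine le_max_of_le_left (hmono s (t - δ) (by linarith) ?_)
      rw [div_le_div_iff₀ (by linarith) ht]
      nlinarith
  obtain ⟨q', hqq', hq't⟩ := exists_between hqt
  obtain ⟨η, hη, hηδ, hnear⟩ : ∃ η, 0 < η ∧ η ≤ δ ∧ ∀ s, |s - t| < η → q' ≤ p s := by
    have h1 : ∀ᶠ s in 𝓝 t, q' < p s := continuousAt_const.eventually_lt hpc.continuousAt hq't
    obtain ⟨η, hη, h2⟩ := Metric.eventually_nhds_iff.1 h1
    refine ⟨min η δ, by positivity, min_le_right _ _, ?_⟩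
    exact fun s hs => (h2 (hs.trans_le (min_le_left _ _))).le
  have hpint : IntegrableOn p (Ioi 0) := by
    refine (integrableOn_pow_mul_exp_neg 1 (one_div_pos.2 ht)).congr_fun (fun s _ => ?_)
      measurableSet_Ioi
    simp only [hp]
    ring_nf
  set I := ∫ s in Ioi (0 : ℝ), p s with hI
  have hq'0 : 0 < q' := hq0.trans hqq'
  have hmain : ∀ m : ℕ, (-(k t / 2)) * q' * (2 * η) * q' ^ m ≤ C * I * q ^ m := by
    intro m
    have hn := h (m + 1) ((m + 1) / t) (by positivity)
    have hpw : ∀ s, s ^ (m + 1) * Real.exp (-((m + 1) / t * s)) = p s ^ (m + 1) := by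
      intro s
      simp only [hp]
      rw [mul_pow, ← Real.exp_nat_mul]
      congr 2
      push_cast
      ring
    simp only [hpw] at hn
    set J : Set ℝ := Ioo (t - η) (t + η) with hJ
    have hJint : IntegrableOn (J.indicator fun _ => k t / 2 * q' ^ (m + 1)) (Ioi 0) := by
      refine ((integrable_indicator_iff measurableSet_Ioo).2 ?_).integrableOn
      exact integrableOn_const (by simp)
    have hle : ∫ s in Ioi (0 : ℝ), p s ^ (m + 1) * k s ≤ ∫ s in Ioi (0 : ℝ),
        (J.indicator (fun _ => k t / 2 * q' ^ (m + 1)) s + C * q ^ m * p s) := by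
      refine setIntegral_mono_on ?_ (hJint.add (hpint.const_mul _)) measurableSet_Ioi ?_
      · refine (integrableOn_pow_mul_exp_neg_mul hk hC (m + 1)
          (x := (m + 1) / t) (by positivity)).congr_fun (fun s _ => ?_) measurableSet_Ioi
        simp only [hpw]
      intro s (hs : 0 < s)
      have hps := hp0 s hs
      have hrest : 0 ≤ C * q ^ m * p s := by positivity
      by_cases hsJ : |s - t| < η
      · have hsJ' : s ∈ J := by
          rw [abs_lt] at hsJ
          exact ⟨by linarith, by linarith⟩
        rw [indicator_of_mem hsJ']
        have h1 : q' ^ (m + 1) ≤ p s ^ (m + 1) := pow_le_pow_left₀ hq'0.le (hnear s hsJ) _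
        have h2 := hkδ s (hsJ.trans_le hηδ)
        have h3 : p s ^ (m + 1) * k s ≤ p s ^ (m + 1) * (k t / 2) := by gcongr
        have h4 : p s ^ (m + 1) * (k t / 2) ≤ q' ^ (m + 1) * (k t / 2) :=
          mul_le_mul_of_nonpos_right h1 (by linarith)
        linarith
      · have hsJ' : s ∉ J := by
          rintro ⟨h1, h2⟩
          exact hsJ (abs_lt.2 ⟨by linarith, by linarith⟩)
        rw [indicator_of_notMem hsJ', zero_add]
        by_cases hsδ : |s - t| < δ
        · have h2 := hkδ s hsδ
          have h3 : p s ^ (m + 1) * k s ≤ 0 :=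
            mul_nonpos_of_nonneg_of_nonpos (by positivity) (by linarith)
          linarith
        · have h1 := hfar s hs (not_lt.1 hsδ)
          calc p s ^ (m + 1) * k s ≤ p s ^ (m + 1) * C := by
                gcongr
                exact (le_abs_self _).trans (hC s hs)
            _ = C * p s ^ m * p s := by ring
            _ ≤ C * q ^ m * p s := by gcongr
    have hval : ∫ s in Ioi (0 : ℝ), J.indicator (fun _ => k t / 2 * q' ^ (m + 1)) s
        = 2 * η * (k t / 2 * q' ^ (m + 1)) := by
      have hsub : Ioi (0 : ℝ) ∩ J = J :=
        inter_eq_right.2 fun s hs => by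
          have := hs.1
          simp only [mem_Ioi]
          linarith
      rw [setIntegral_indicator measurableSet_Ioo, hsub, setIntegral_const, hJ,
        Measure.real, Real.volume_Ioo, ENNReal.toReal_ofReal (by linarith), smul_eq_mul]
      ring
    rw [integral_add hJint (hpint.const_mul _), integral_const_mul, hval] at hle
    have := hn.trans hle
    rw [pow_succ] at this
    linarith
  -- the left side grows faster than the right side, since `q < q'`
  have hA : 0 < (-(k t / 2)) * q' * (2 * η) := by
    have : 0 < -(k t / 2) := by linarith
    positivity
  obtain ⟨m, hm⟩ := pow_unbounded_of_one_lt (C * I / ((-(k t / 2)) * q' * (2 * η)))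
    ((one_lt_div hq0).2 hqq')
  rw [div_pow, div_lt_div_iff₀ hA (by positivity)] at hm
  have := hmain m
  linarith

end Laplace

/-! ### The renewal sequence and its generating function -/

/-- The sequence with `renewalSeq 0 = 2` and
`renewalSeq n = ∑_{k=1}^{n} 2 / ((k+1)(k+2)) * renewalSeq (n-k)` for `n ≥ 1`: twice the renewal
sequence of the probability distribution `2 / ((k+1)(k+2))`, `k ≥ 1`. -/
noncomputable def renewalSeq : ℕ → ℝ
  | 0 => 2
  | n + 1 => ∑ i : Fin (n + 1), 2 / (((n - i : ℕ) + 2) * ((n - i : ℕ) + 3)) * renewalSeq i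

@[simp]
theorem renewalSeq_zero : renewalSeq 0 = 2 := by rw [renewalSeq]

theorem renewalSeq_succ (n : ℕ) :
    renewalSeq (n + 1) = ∑ i ∈ Finset.range (n + 1),
      2 / (((n - i : ℕ) + 2 : ℝ) * ((n - i : ℕ) + 3)) * renewalSeq i := by
  rw [renewalSeq, ← Fin.sum_univ_eq_sum_range
    (fun i => 2 / (((n - i : ℕ) + 2 : ℝ) * ((n - i : ℕ) + 3)) * renewalSeq i)]

theorem sum_renewal_weight (n : ℕ) :
    ∑ i ∈ Finset.range n, 2 / ((i + 2 : ℝ) * (i + 3)) = 1 - 2 / (n + 2) := by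
  induction n with
  | zero => norm_num
  | succ n ih =>
    rw [Finset.sum_range_succ, ih]
    push_cast
    field_simp
    ring

/-- The weights of the renewal equation for `renewalSeq (n + 1)` have total mass at most `1`. -/
theorem sum_renewal_weight_reflect (n : ℕ) :
    ∑ i ∈ Finset.range (n + 1), 2 / (((n - i : ℕ) + 2 : ℝ) * ((n - i : ℕ) + 3))
      = 1 - 2 / (n + 3) := by
  have h := Finset.sum_range_reflect (fun i : ℕ => 2 / ((i + 2 : ℝ) * (i + 3))) (n + 1)
  simp only [Nat.add_sub_cancel] at h
  rw [h, sum_renewal_weight]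
  push_cast
  ring

theorem renewalSeq_mem_Icc (n : ℕ) : renewalSeq n ∈ Icc (0 : ℝ) 2 := by
  induction n using Nat.strong_induction_on with
  | _ n ih =>
    cases n with
    | zero => simp
    | succ n =>
      rw [renewalSeq_succ]
      constructor
      · refine Finset.sum_nonneg fun i hi => mul_nonneg (by positivity) ?_
        exact (ih i (Finset.mem_range.1 hi)).1
      · calc ∑ i ∈ Finset.range (n + 1),
              2 / (((n - i : ℕ) + 2 : ℝ) * ((n - i : ℕ) + 3)) * renewalSeq i
            ≤ ∑ i ∈ Finset.range (n + 1),
              2 / (((n - i : ℕ) + 2 : ℝ) * ((n - i : ℕ) + 3)) * 2 :=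
              Finset.sum_le_sum fun i hi =>
                mul_le_mul_of_nonneg_left (ih i (Finset.mem_range.1 hi)).2 (by positivity)
          _ = (1 - 2 / (n + 3)) * 2 := by rw [← Finset.sum_mul, sum_renewal_weight_reflect]
          _ ≤ 2 := by
              have : (0 : ℝ) ≤ 2 / (n + 3) := by positivity
              linarith

theorem abs_renewalSeq_le (n : ℕ) : |renewalSeq n| ≤ 2 := by
  rw [abs_of_nonneg (renewalSeq_mem_Icc n).1]
  exact (renewalSeq_mem_Icc n).2

theorem summable_mul_pow {d : ℕ → ℝ} {C : ℝ} (hd : ∀ n, |d n| ≤ C) {v : ℝ} (hv : |v| < 1) :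
    Summable fun n => ‖d n * v ^ n‖ := by
  refine Summable.of_nonneg_of_le (fun _ => norm_nonneg _) (fun n => ?_)
    ((summable_geometric_of_lt_one (abs_nonneg v) hv).mul_left C)
  rw [norm_mul, norm_pow, Real.norm_eq_abs, Real.norm_eq_abs]
  gcongr
  exact hd n

/-- The renewal equation `A = 2 + v P A` for the generating function `A = ∑ renewalSeq n vⁿ`, where
`P = ∑ 2 / ((k+2)(k+3)) v^k`. -/
theorem tsum_renewalSeq_eq {v : ℝ} (hv : |v| < 1) :
    ∑' n, renewalSeq n * v ^ n
      = 2 + v * ((∑' n, renewalSeq n * v ^ n) * ∑' k : ℕ, 2 / ((k + 2 : ℝ) * (k + 3)) * v ^ k) := by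
  have hA := summable_mul_pow abs_renewalSeq_le hv
  have hP : Summable fun k : ℕ => ‖2 / ((k + 2 : ℝ) * (k + 3)) * v ^ k‖ := by
    refine summable_mul_pow (C := 2) (fun k => ?_) hv
    rw [abs_of_nonneg (by positivity)]
    refine div_le_self (by norm_num) ?_
    have : (0 : ℝ) ≤ k := k.cast_nonneg
    nlinarith
  rw [tsum_mul_tsum_eq_tsum_sum_range_of_summable_norm hA hP, ← tsum_mul_left]
  rw [hA.of_norm.tsum_eq_zero_add]
  congr 1
  · simp
  refine tsum_congr fun n => ?_
  rw [renewalSeq_succ, Finset.sum_mul, Finset.mul_sum]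
  refine Finset.sum_congr rfl fun i hi => ?_
  have hin : i ≤ n := Nat.lt_succ_iff.1 (Finset.mem_range.1 hi)
  rw [show v ^ (n + 1) = v * (v ^ i * v ^ (n - i)) by
    rw [← pow_add, Nat.add_sub_cancel' hin, pow_succ']]
  ring

/-- The generating function of the weights `2 / ((k+2)(k+3))` in closed form. -/
theorem tsum_renewal_weight {v : ℝ} (hv : |v| < 1) :
    v ^ 3 * ∑' k : ℕ, 2 / ((k + 2 : ℝ) * (k + 3)) * v ^ k
      = v ^ 2 - 2 * (1 - v) * (-Real.log (1 - v) - v) := by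
  have h1 := Real.hasSum_pow_div_log_of_abs_lt_one hv
  have h2 := (hasSum_nat_add_iff' 1).2 h1
  have h3 := (hasSum_nat_add_iff' 2).2 h1
  have h4 := (h2.mul_left (2 * v)).sub (h3.mul_left 2)
  have h5 : ∀ k : ℕ, v ^ 3 * (2 / ((k + 2 : ℝ) * (k + 3)) * v ^ k)
      = 2 * v * (v ^ (k + 1 + 1) / ((k + 1 : ℕ) + 1)) - 2 * (v ^ (k + 2 + 1) / ((k + 2 : ℕ) +
        1)) := by
    intro k
    push_cast
    field_simp
    ring
  rw [← tsum_mul_left, tsum_congr h5, h4.tsum_eq]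
  norm_num [Finset.sum_range_succ]
  ring

/-- The Taylor coefficients `1 / (n+1)` of `-log (1 - v) / v`, with the constant term removed. -/
noncomputable def logCoeff (n : ℕ) : ℝ := if n = 0 then 0 else 1 / (n + 1)

theorem abs_logCoeff_le (n : ℕ) : |logCoeff n| ≤ 1 := by
  unfold logCoeff
  split_ifs
  · simp
  · rw [abs_of_nonneg (by positivity)]
    exact div_le_self zero_le_one (by linarith [n.cast_nonneg (α := ℝ)])

theorem logCoeff_nonneg (n : ℕ) : 0 ≤ logCoeff n := by
  unfold logCoeff
  split_ifs
  · rfl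
  · positivity

theorem abs_one_div_one_add_lt_one {x : ℝ} (hx : 0 < x) : |1 / (1 + x)| < 1 := by
  rw [abs_of_pos (by positivity), div_lt_one (by positivity)]
  linarith

theorem neg_log_one_sub_one_div {x : ℝ} (hx : 0 < x) :
    -Real.log (1 - 1 / (1 + x)) = Real.log (1 + 1 / x) := by
  rw [← Real.log_inv]
  congr 1
  have : 1 - 1 / (1 + x) = x / (1 + x) := by field_simp; ring
  rw [this]
  field_simp
  ring

/-- The derivative of `x log (1 + 1/x)` as a power series in `1 / (1 + x)`. -/
theorem tsum_logCoeff {x : ℝ} (hx : 0 < x) :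
    ∑' n, logCoeff n * (1 / (1 + x)) ^ (n + 1) = Real.log (1 + 1 / x) - 1 / (x + 1) := by
  have h1 := Real.hasSum_pow_div_log_of_abs_lt_one (abs_one_div_one_add_lt_one hx)
  rw [neg_log_one_sub_one_div hx] at h1
  have h2 := h1.sub (hasSum_ite_eq (0 : ℕ) (1 / (x + 1)))
  rw [← h2.tsum_eq]
  refine tsum_congr fun n => ?_
  unfold logCoeff
  split_ifs with h
  · subst h
    simp [add_comm]
  · ring

theorem log_one_add_one_div_sub_pos {x : ℝ} (hx : 0 < x) :
    0 < Real.log (1 + 1 / x) - 1 / (x + 1) := by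
  have h := Real.log_lt_sub_one_of_pos (x := x / (x + 1)) (by positivity) (by
    rw [Ne, div_eq_one_iff_eq (by positivity)]
    linarith)
  have h2 : 1 + 1 / x = (x / (x + 1))⁻¹ := by field_simp
  have h3 : x / (x + 1) - 1 = -(1 / (x + 1)) := by field_simp; ring
  rw [h2, Real.log_inv]
  linarith

/-- With `g x = x log (1 + 1/x)`, this is the expansion of `-g'' / g'` in powers of
`1 / (1 + x)`. -/
theorem tsum_renewalSeq {x : ℝ} (hx : 0 < x) :
    ∑' n, renewalSeq n * (1 / (1 + x)) ^ (n + 1)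
      = 1 / (x * (x + 1) ^ 2 * (Real.log (1 + 1 / x) - 1 / (x + 1))) := by
  have hv := abs_one_div_one_add_lt_one hx
  have h1 := tsum_renewalSeq_eq hv
  have h2 := tsum_renewal_weight hv
  rw [neg_log_one_sub_one_div hx] at h2
  have hpos := log_one_add_one_div_sub_pos hx
  have hpow : ∀ n, renewalSeq n * (1 / (1 + x)) ^ (n + 1)
      = 1 / (1 + x) * (renewalSeq n * (1 / (1 + x)) ^ n) := fun n => by ring
  rw [tsum_congr hpow, tsum_mul_left]
  rw [add_comm x 1] at hpos ⊢
  have hvx : (1 / (1 + x)) * (1 + x) = 1 := by field_simp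
  generalize ∑' n, renewalSeq n * (1 / (1 + x)) ^ n = A at h1 ⊢
  generalize ∑' k : ℕ, 2 / ((k + 2 : ℝ) * (k + 3)) * (1 / (1 + x)) ^ k = P at h1 h2
  generalize 1 / (1 + x) = v at *
  generalize Real.log (1 + 1 / x) = l at *
  have h3 : A * (1 - v) * (l - v) = v ^ 2 := by linear_combination v ^ 2 / 2 * h1 + A / 2 * h2
  rw [eq_div_iff (by positivity)]
  have h4 : (1 - v) * (1 + x) = x := by linear_combination -hvx
  calc v * A * (x * (1 + x) ^ 2 * (l - v))
      = v * (1 + x) ^ 3 * (A * (1 - v) * (l - v)) := by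
        linear_combination -v * A * (1 + x) ^ 2 * (l - v) * h4
    _ = (v * (1 + x)) ^ 3 := by rw [h3]; ring
    _ = 1 := by rw [hvx, one_pow]

theorem abs_renewalSeq_sub_le (a : ℝ) (n : ℕ) : |renewalSeq n - a * logCoeff n| ≤ 2 + |a| := by
  refine (abs_sub _ _).trans (add_le_add (abs_renewalSeq_le n) ?_)
  rw [abs_mul]
  exact mul_le_of_le_one_right (abs_nonneg a) (abs_logCoeff_le n)

/-! ### Numerical bounds for the ratio of the generating functions -/

theorem sum_range_le_expGenFun {d : ℕ → ℝ} {C : ℝ} (hd : ∀ n, |d n| ≤ C) {N : ℕ}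
    (hN : ∀ n, N ≤ n → 0 ≤ d n) {s : ℝ} (hs : 0 ≤ s) :
    ∑ n ∈ Finset.range N, d n * (s ^ n / n !) ≤ expGenFun d s :=
  (summable_expGenFun hd s).sum_le_tsum _ fun n hn =>
    mul_nonneg (hN n (not_lt.1 fun h => hn (Finset.mem_range.2 h))) (by positivity)

theorem expGenFun_const (c s : ℝ) : expGenFun (fun _ => c) s = c * Real.exp s := by
  rw [Real.exp_eq_exp_ℝ]
  exact ((NormedSpace.expSeries_div_hasSum_exp s).mul_left c).tsum_eq

theorem renewalSeq_1 : renewalSeq 1 = 2/3 := by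
  rw [renewalSeq_succ]
  norm_num [Finset.sum_range_succ]

theorem renewalSeq_2 : renewalSeq 2 = 5/9 := by
  rw [renewalSeq_succ]
  norm_num [Finset.sum_range_succ, renewalSeq_1]

theorem renewalSeq_3 : renewalSeq 3 = 67/135 := by
  rw [renewalSeq_succ]
  norm_num [Finset.sum_range_succ, renewalSeq_1, renewalSeq_2]

theorem renewalSeq_4 : renewalSeq 4 = 371/810 := by
  rw [renewalSeq_succ]
  norm_num [Finset.sum_range_succ, renewalSeq_1, renewalSeq_2, renewalSeq_3]

theorem renewalSeq_5 : renewalSeq 5 = 1465/3402 := by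
  rw [renewalSeq_succ]
  norm_num [Finset.sum_range_succ, renewalSeq_1, renewalSeq_2, renewalSeq_3, renewalSeq_4]

theorem renewalSeq_6 : renewalSeq 6 = 209081/510300 := by
  rw [renewalSeq_succ]
  norm_num [Finset.sum_range_succ, renewalSeq_1, renewalSeq_2, renewalSeq_3, renewalSeq_4,
    renewalSeq_5]

theorem renewalSeq_7 : renewalSeq 7 = 85961/218700 := by
  rw [renewalSeq_succ]
  norm_num [Finset.sum_range_succ, renewalSeq_1, renewalSeq_2, renewalSeq_3, renewalSeq_4,
    renewalSeq_5, renewalSeq_6]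

theorem renewalSeq_8 : renewalSeq 8 = 3484393/9185400 := by
  rw [renewalSeq_succ]
  norm_num [Finset.sum_range_succ, renewalSeq_1, renewalSeq_2, renewalSeq_3, renewalSeq_4,
    renewalSeq_5, renewalSeq_6, renewalSeq_7]

theorem renewalSeq_9 : renewalSeq 9 = 557408227/1515591000 := by
  rw [renewalSeq_succ]
  norm_num [Finset.sum_range_succ, renewalSeq_1, renewalSeq_2, renewalSeq_3, renewalSeq_4,
    renewalSeq_5, renewalSeq_6, renewalSeq_7, renewalSeq_8]

theorem renewalSeq_10 : renewalSeq 10 = 4555877041/12730964400 := by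
  rw [renewalSeq_succ]
  norm_num [Finset.sum_range_succ, renewalSeq_1, renewalSeq_2, renewalSeq_3, renewalSeq_4,
    renewalSeq_5, renewalSeq_6, renewalSeq_7, renewalSeq_8, renewalSeq_9]

theorem renewalSeq_11 : renewalSeq 11 = 78810586873/225685278000 := by
  rw [renewalSeq_succ]
  norm_num [Finset.sum_range_succ, renewalSeq_1, renewalSeq_2, renewalSeq_3, renewalSeq_4,
    renewalSeq_5, renewalSeq_6, renewalSeq_7, renewalSeq_8, renewalSeq_9, renewalSeq_10]

theorem renewalSeq_12 : renewalSeq 12 = 25438717237553/74476141740000 := by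
  rw [renewalSeq_succ]
  norm_num [Finset.sum_range_succ, renewalSeq_1, renewalSeq_2, renewalSeq_3, renewalSeq_4,
    renewalSeq_5, renewalSeq_6, renewalSeq_7, renewalSeq_8, renewalSeq_9, renewalSeq_10,
    renewalSeq_11]

theorem renewalSeq_13 : renewalSeq 13 = 5753410810493/17186801940000 := by
  rw [renewalSeq_succ]
  norm_num [Finset.sum_range_succ, renewalSeq_1, renewalSeq_2, renewalSeq_3, renewalSeq_4,
    renewalSeq_5, renewalSeq_6, renewalSeq_7, renewalSeq_8, renewalSeq_9, renewalSeq_10,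
    renewalSeq_11, renewalSeq_12]

/-- In the renewal equation for `renewalSeq n` every term of index `1, …, n - 1` is at least
`2.19 / n` by induction, and the term of index `0` makes up for the loss from `n` to `n + 1`. -/
theorem renewalSeq_ge {n : ℕ} (hn : 4 ≤ n) : 2.19 / (n + 1) ≤ renewalSeq n := by
  induction n using Nat.strong_induction_on with
  | _ n ih =>
    obtain rfl | hn5 := hn.eq_or_lt
    · rw [renewalSeq_4]
      norm_num
    obtain ⟨m, rfl⟩ : ∃ m, n = m + 1 := ⟨n - 1, by omega⟩
    have hm : (4 : ℝ) ≤ m := by exact_mod_cast Nat.lt_succ_iff.1 hn5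
    have hterm : ∀ i ∈ Finset.range m, 2.19 / (m + 1) ≤ renewalSeq (i + 1) := by
      intro i hi
      have him : i + 1 ≤ m := Finset.mem_range.1 hi
      have h5 : (2.19 : ℝ) / (m + 1) ≤ 2.19 / 5 := by gcongr; linarith
      rcases Nat.lt_or_ge (i + 1) 4 with h4 | h4
      · refine h5.trans ?_
        have : i < 3 := by omega
        interval_cases i
        · rw [renewalSeq_1]; norm_num
        · rw [renewalSeq_2]; norm_num
        · rw [renewalSeq_3]; norm_num
      · refine le_trans ?_ (ih (i + 1) (by omega) h4)
        have : ((i + 1 : ℕ) : ℝ) ≤ m := by exact_mod_cast him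
        gcongr
    have hw := sum_renewal_weight_reflect m
    rw [Finset.sum_range_succ'] at hw
    rw [renewalSeq_succ, Finset.sum_range_succ']
    have hsum : (∑ i ∈ Finset.range m,
          2 / (((m - (i + 1) : ℕ) + 2 : ℝ) * ((m - (i + 1) : ℕ) + 3))) * (2.19 / (m + 1))
        ≤ ∑ i ∈ Finset.range m,
          2 / (((m - (i + 1) : ℕ) + 2 : ℝ) * ((m - (i + 1) : ℕ) + 3)) * renewalSeq (i + 1) := by
      rw [Finset.sum_mul]
      exact Finset.sum_le_sum fun i hi =>
        mul_le_mul_of_nonneg_left (hterm i hi) (by positivity)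
    rw [← eq_sub_iff_add_eq] at hw
    rw [hw] at hsum
    refine le_trans ?_ (add_le_add_left hsum _)
    simp only [Nat.sub_zero, renewalSeq_zero]
    push_cast
    rw [← sub_nonneg]
    have e : (1 - 2 / ((m : ℝ) + 3) - 2 / ((m + 2) * (m + 3))) * (2.19 / (m + 1))
        + 2 / ((m + 2) * (m + 3)) * 2 - 2.19 / (m + 1 + 1)
        = (1.81 * m - 2.57) / ((m + 1) * (m + 2) * (m + 3)) := by
      field_simp
      ring
    rw [e]
    apply div_nonneg <;> [linarith; positivity]

/-- The difference of the two exponential generating functions at `a = 2.18852`. Its coefficients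
are nonnegative from index `4` on, so it suffices to bound the Taylor polynomial of degree `13`. -/
theorem mul_expGenFun_logCoeff_le {s : ℝ} (hs : 0 ≤ s) :
    2.18852 * expGenFun logCoeff s ≤ expGenFun renewalSeq s := by
  rw [← sub_nonneg, ← expGenFun_sub_const_mul abs_renewalSeq_le abs_logCoeff_le]
  have hbdd := abs_renewalSeq_sub_le 2.18852
  refine le_trans ?_ (sum_range_le_expGenFun hbdd (N := 14) (fun n hn => ?_) hs)
  · -- The point `6731 / 2000` is close to the minimum point of this polynomial, whose minimum is
    -- slightly positive. The second factor below is the quotient of the polynomial by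
    -- `(s - 6731 / 2000) ^ 2`, rounded down: the polynomial has two sign changes, so the quotient
    -- by (nearly) a double positive root has positive coefficients. What remains after subtracting
    -- the product has nonnegative coefficients.
    have hq : 0 ≤ (s - 6731 / 2000) ^ 2 * ((1765463328281654 + 671617752161163 * s +
        166461411982267 * s ^ 2 + 32146582894645 * s ^ 3 + 5154613253013 * s ^ 4 +
        709724736323 * s ^ 5 + 85711759137 * s ^ 6 + 9206943984 * s ^ 7 + 885780136 * s ^ 8 +
        75872291 * s ^ 9 + 5545047 * s ^ 10 + 286548 * s ^ 11) / 10 ^ 16) := by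
      positivity
    simp only [Finset.sum_range_succ, Finset.sum_range_zero, renewalSeq_zero, renewalSeq_1,
      renewalSeq_2, renewalSeq_3, renewalSeq_4, renewalSeq_5, renewalSeq_6,
    renewalSeq_7, renewalSeq_8, renewalSeq_9, renewalSeq_10, renewalSeq_11, renewalSeq_12,
    renewalSeq_13,
      logCoeff, Nat.factorial]
    norm_num
    linarith [hq, hs, pow_nonneg hs 2, pow_nonneg hs 3, pow_nonneg hs 4, pow_nonneg hs 5,
      pow_nonneg hs 6, pow_nonneg hs 7, pow_nonneg hs 8, pow_nonneg hs 9, pow_nonneg hs 10,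
      pow_nonneg hs 11, pow_nonneg hs 12, pow_nonneg hs 13]
  · have h := renewalSeq_ge (show 4 ≤ n by omega)
    have hl : logCoeff n = 1 / (n + 1) := if_neg (by omega)
    rw [hl, sub_nonneg, mul_one_div]
    refine le_trans ?_ h
    gcongr
    norm_num

theorem exp_ten_div_three_lt : Real.exp (10 / 3) < 28.0317 := by
  refine lt_of_pow_lt_pow_left₀ 3 (by norm_num) ?_
  have h : Real.exp (10 / 3) ^ 3 = Real.exp 1 ^ 10 := by
    rw [← Real.exp_nat_mul, ← Real.exp_nat_mul]
    norm_num
  rw [h]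
  calc Real.exp 1 ^ 10 < 2.7182818286 ^ 10 := by
        gcongr
        exact Real.exp_one_lt_d9
    _ < 28.0317 ^ 3 := by norm_num

/-- The difference of the generating functions at `a = 2.189` is negative at a point close to the
minimum point `3.366…` of their ratio. The coefficients of the difference are at most `2`, so its
Taylor remainder is bounded by that of `2 e^s`. -/
theorem expGenFun_renewalSeq_lt :
    expGenFun renewalSeq (10 / 3) < 2.189 * expGenFun logCoeff (10 / 3) := by
  have hbdd := abs_renewalSeq_sub_le 2.189
  have hbdd2 : ∀ n, |2 - 1 * (renewalSeq n - 2.189 * logCoeff n)| ≤ 2 + (2 + |2.189|) :=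
    fun n => by
      rw [one_mul]
      exact (abs_sub _ _).trans (add_le_add (by norm_num) (hbdd n))
  have h := sum_range_le_expGenFun hbdd2 (N := 14) (s := 10 / 3) (fun n _ => by
    have h1 := (renewalSeq_mem_Icc n).2
    have h2 := logCoeff_nonneg n
    linarith) (by norm_num)
  rw [expGenFun_sub_const_mul (d := fun _ => 2) (C := 2) (by simp) hbdd,
    expGenFun_sub_const_mul abs_renewalSeq_le abs_logCoeff_le, expGenFun_const] at h
  have he := exp_ten_div_three_lt
  simp only [Finset.sum_range_succ, Finset.sum_range_zero, renewalSeq_zero, renewalSeq_1,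
    renewalSeq_2, renewalSeq_3, renewalSeq_4, renewalSeq_5, renewalSeq_6,
    renewalSeq_7, renewalSeq_8, renewalSeq_9, renewalSeq_10, renewalSeq_11, renewalSeq_12,
    renewalSeq_13,
    logCoeff, Nat.factorial] at h
  norm_num at h
  linarith

/-! ### Derivatives and Laplace representation for the Horn function -/

theorem hornFun_eq_exp {a x : ℝ} (hx : 0 < x) :
    hornFun a x = Real.exp (Real.log (1 + 1 / x) * (a * x)) :=
  Real.rpow_def_of_pos (by positivity) _

theorem hornFun_pos {a x : ℝ} (hx : 0 < x) : 0 < hornFun a x := by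
  rw [hornFun_eq_exp hx]
  exact Real.exp_pos _

theorem contDiffOn_hornFun (a : ℝ) : ContDiffOn ℝ ∞ (hornFun a) (Ioi 0) := by
  refine ContDiffOn.congr (f := fun x => Real.exp (Real.log (1 + 1 / x) * (a * x))) ?_
    fun x hx => hornFun_eq_exp hx
  refine ContDiffOn.exp (ContDiffOn.mul (ContDiffOn.log ?_ ?_) (by fun_prop))
  · exact contDiffOn_const.add (contDiffOn_const.div contDiffOn_id fun x hx => ne_of_gt hx)
  · intro x (hx : 0 < x)
    positivity

theorem hasDerivAt_log_one_add_one_div {x : ℝ} (hx : 0 < x) :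
    HasDerivAt (fun y => Real.log (1 + 1 / y)) (-(1 / (x * (x + 1)))) x := by
  have h1 : HasDerivAt (fun y : ℝ => 1 + 1 / y) (-(x ^ 2)⁻¹) x := by
    simpa only [one_div] using (hasDerivAt_inv hx.ne').const_add 1
  refine (h1.log (by positivity)).congr_deriv ?_
  field_simp

theorem hasDerivAt_log_one_add_one_div_sub {x : ℝ} (hx : 0 < x) :
    HasDerivAt (fun y => Real.log (1 + 1 / y) - 1 / (y + 1)) (-(1 / (x * (x + 1) ^ 2))) x := by
  have h1 : HasDerivAt (fun y : ℝ => 1 / (y + 1)) (-1 / (x + 1) ^ 2) x := by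
    simpa only [one_div] using ((hasDerivAt_id' x).add_const 1).fun_inv (by positivity)
  refine ((hasDerivAt_log_one_add_one_div hx).sub h1).congr_deriv ?_
  field_simp
  ring

theorem hasDerivAt_hornFun (a : ℝ) {x : ℝ} (hx : 0 < x) :
    HasDerivAt (hornFun a) (a * hornFun a x * (Real.log (1 + 1 / x) - 1 / (x + 1))) x := by
  have h1 := ((hasDerivAt_log_one_add_one_div hx).mul ((hasDerivAt_id' x).const_mul a)).exp
  have h2 : hornFun a =ᶠ[𝓝 x] fun y => Real.exp (Real.log (1 + 1 / y) * (a * y)) := by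
    filter_upwards [Ioi_mem_nhds hx] with y hy using hornFun_eq_exp hy
  refine (h1.congr_of_eventuallyEq h2).congr_deriv ?_
  rw [hornFun_eq_exp hx]
  simp only [Pi.mul_apply]
  field_simp
  ring

theorem deriv_hornFun_eventuallyEq (a : ℝ) {x : ℝ} (hx : 0 < x) :
    deriv (hornFun a) =ᶠ[𝓝 x]
      fun y => a * hornFun a y * (Real.log (1 + 1 / y) - 1 / (y + 1)) := by
  filter_upwards [Ioi_mem_nhds hx] with y hy using (hasDerivAt_hornFun a hy).deriv

theorem deriv_hornFun_pos {a x : ℝ} (ha : 0 < a) (hx : 0 < x) : 0 < deriv (hornFun a) x := by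
  rw [(hasDerivAt_hornFun a hx).deriv]
  have := hornFun_pos (a := a) hx
  have := log_one_add_one_div_sub_pos hx
  positivity

/-- The density whose Laplace transform is `-(log h_a')'`. -/
noncomputable def hornDensity (a s : ℝ) : ℝ :=
  Real.exp (-s) * (expGenFun renewalSeq s - a * expGenFun logCoeff s)

/-- With `g x = x log (1 + 1/x)` and `h = exp (a g)` one has `h' = a g' h`, hence
`-h'' / h' = -g'' / g' - a g'`. -/
theorem neg_logDeriv_deriv_hornFun {a x : ℝ} (ha : 0 < a) (hx : 0 < x) :
    -(deriv (deriv (hornFun a)) x / deriv (hornFun a) x)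
      = 1 / (x * (x + 1) ^ 2 * (Real.log (1 + 1 / x) - 1 / (x + 1)))
        - a * (Real.log (1 + 1 / x) - 1 / (x + 1)) := by
  have h1 := (((hasDerivAt_hornFun a hx).const_mul a).mul
    (hasDerivAt_log_one_add_one_div_sub hx)).congr_of_eventuallyEq (deriv_hornFun_eventuallyEq a hx)
  rw [h1.deriv, (hasDerivAt_hornFun a hx).deriv]
  have := hornFun_pos (a := a) hx
  have := log_one_add_one_div_sub_pos hx
  generalize Real.log (1 + 1 / x) - 1 / (x + 1) = g at *
  field_simp
  ring

theorem hornDensity_eq (a s : ℝ) :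
    hornDensity a s
      = Real.exp (-s) * expGenFun (fun n => renewalSeq n - a * logCoeff n) s := by
  rw [hornDensity, expGenFun_sub_const_mul abs_renewalSeq_le abs_logCoeff_le]

theorem continuous_hornDensity (a : ℝ) : Continuous (hornDensity a) := by
  have h1 := continuous_expGenFun abs_renewalSeq_le
  have h2 := continuous_expGenFun abs_logCoeff_le
  unfold hornDensity
  fun_prop

theorem abs_hornDensity_le (a : ℝ) {s : ℝ} (hs : 0 < s) : |hornDensity a s| ≤ 2 + |a| := by
  rw [hornDensity_eq, abs_mul, abs_of_pos (Real.exp_pos _)]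
  calc Real.exp (-s) * |expGenFun (fun n => renewalSeq n - a * logCoeff n) s|
      ≤ Real.exp (-s) * ((2 + |a|) * Real.exp s) := by
        gcongr
        exact abs_expGenFun_le (abs_renewalSeq_sub_le a) hs.le
    _ = (2 + |a|) * (Real.exp (-s) * Real.exp s) := by ring
    _ = 2 + |a| := by rw [← Real.exp_add]; simp

theorem neg_logDeriv_deriv_hornFun_eq_laplace {a x : ℝ} (ha : 0 < a) (hx : 0 < x) :
    -(deriv (deriv (hornFun a)) x / deriv (hornFun a) x)
      = ∫ s in Ioi (0 : ℝ), Real.exp (-(x * s)) * hornDensity a s := by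
  have hv := abs_one_div_one_add_lt_one hx
  have hs1 : Summable fun n => renewalSeq n * (1 / (1 + x)) ^ (n + 1) := by
    simpa only [pow_succ, mul_assoc] using
      (summable_mul_pow abs_renewalSeq_le hv).of_norm.mul_right (1 / (1 + x))
  have hs2 : Summable fun n => logCoeff n * (1 / (1 + x)) ^ (n + 1) := by
    simpa only [pow_succ, mul_assoc] using
      (summable_mul_pow abs_logCoeff_le hv).of_norm.mul_right (1 / (1 + x))
  simp only [hornDensity_eq]
  rw [integral_exp_neg_mul_expGenFun (abs_renewalSeq_sub_le a) hx,
    neg_logDeriv_deriv_hornFun ha hx, ← tsum_renewalSeq hx, ← tsum_logCoeff hx, ← tsum_mul_left,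
    ← hs1.tsum_sub (hs2.mul_left a)]
  exact tsum_congr fun n => by ring

/-- The smoothness and positivity requirements hold for every `a > 0`, so the property is decided
by the sign of the density of `-(log h_a')'`. -/
theorem isHornBernstein_hornFun_iff {a : ℝ} (ha : 0 < a) :
    IsHornBernstein (hornFun a) ↔ ∀ s, 0 < s → 0 ≤ hornDensity a s := by
  have hc := contDiffOn_hornFun a
  have hc1 : ContDiffOn ℝ ∞ (deriv (hornFun a)) (Ioi 0) := hc.deriv_of_isOpen isOpen_Ioi (by simp)
  have hc2 : ContDiffOn ℝ ∞ (deriv (deriv (hornFun a))) (Ioi 0) :=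
    hc1.deriv_of_isOpen isOpen_Ioi (by simp)
  have hc3 : ContDiffOn ℝ ∞ (fun x => -(deriv (deriv (hornFun a)) x / deriv (hornFun a) x))
      (Ioi 0) := (hc2.div hc1 fun x hx => (deriv_hornFun_pos ha hx).ne').neg
  have hiter : ∀ (n : ℕ) (x : ℝ), 0 < x → (-1 : ℝ) ^ n * iteratedDeriv n
        (fun x => -(deriv (deriv (hornFun a)) x / deriv (hornFun a) x)) x
      = ∫ s in Ioi (0 : ℝ), s ^ n * Real.exp (-(x * s)) * hornDensity a s := by
    intro n x hx
    rw [← iteratedDeriv_laplace (continuous_hornDensity a) (fun s hs => abs_hornDensity_le a hs)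
      n hx]
    congr 1
    refine Filter.EventuallyEq.iteratedDeriv_eq n ?_
    filter_upwards [Ioi_mem_nhds hx] with y hy using neg_logDeriv_deriv_hornFun_eq_laplace ha hy
  constructor
  · rintro ⟨-, -, -, -, -, h⟩ s hs
    refine nonneg_of_forall_integral_nonneg (continuous_hornDensity a)
      (fun s hs => abs_hornDensity_le a hs) (fun n x hx => ?_) hs
    rw [← hiter n x hx]
    exact h n x hx
  · intro h
    refine ⟨hc, fun x hx => hornFun_pos hx, hc1, fun x hx => deriv_hornFun_pos ha hx, hc3, ?_⟩
    intro n x hx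
    rw [hiter n x hx]
    refine setIntegral_nonneg measurableSet_Ioi fun s hs => ?_
    have hs' : 0 < s := hs
    have := h s hs'
    positivity

/-! ### The critical exponent -/

theorem expGenFun_logCoeff_pos {s : ℝ} (hs : 0 < s) : 0 < expGenFun logCoeff s := by
  refine (summable_expGenFun abs_logCoeff_le s).tsum_pos
    (fun n => mul_nonneg (logCoeff_nonneg n) (by positivity)) 1 ?_
  norm_num [logCoeff]
  exact hs

theorem mainTheorem2 :
    ∃ b : ℝ, 0 < b ∧ |b - 2.189| < 0.0005 ∧
      ∀ a : ℝ, 0 < a → (IsHornBernstein (hornFun a) ↔ a ≤ b) := by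
  set R : Set ℝ := (fun s => expGenFun renewalSeq s / expGenFun logCoeff s) '' Ioi 0 with hR
  have hne : R.Nonempty := (nonempty_Ioi).image _
  have hlow : ∀ r ∈ R, (2.18852 : ℝ) ≤ r := by
    rintro _ ⟨s, hs, rfl⟩
    rw [le_div_iff₀ (expGenFun_logCoeff_pos hs)]
    exact mul_expGenFun_logCoeff_le (le_of_lt hs)
  have hbdd : BddBelow R := ⟨_, hlow⟩
  have h1 : 2.18852 ≤ sInf R := le_csInf hne hlow
  have h2 : sInf R < 2.189 := by
    refine (csInf_le hbdd ⟨10 / 3, by norm_num, rfl⟩).trans_lt ?_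
    rw [div_lt_iff₀ (expGenFun_logCoeff_pos (by norm_num))]
    exact expGenFun_renewalSeq_lt
  refine ⟨sInf R, by linarith, abs_lt.2 ⟨by linarith, by linarith⟩, fun a ha => ?_⟩
  rw [isHornBernstein_hornFun_iff ha, le_csInf_iff hbdd hne, hR, forall_mem_image]
  refine forall₂_congr fun s hs => ?_
  rw [hornDensity, le_div_iff₀ (expGenFun_logCoeff_pos hs), mul_nonneg_iff_of_pos_left
    (Real.exp_pos _), sub_nonneg]
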